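/- Let $\mathbb K$ be a field, $d\ge 0$ an integer, $\mathcal A$ a $\mathbb K$-algebra isomorphic to $\mathrm{Mat}_{d+1}(\mathbb K)$, and $V$ a simple left $\mathcal A$-module. An element of $\mathcal A$ is multiplicity-free if it has $d+1$ distinct eigenvalues in $\mathbb K$; its primitive idempotent associated with the eigenvalue $\theta_i$ is then $\prod_{j\ne i}(A-\theta_jI)/(\theta_i-\theta_j)$, where $\theta_0,\dots,\theta_d$ are its eigenvalues. Let $\Phi=(A;\{E_i\}_{i=0}^d;A^*;\{E_i^*\}_{i=0}^d)$ be a Leonard system in $\mathcal A$; that is, $A,A^*\in\mathcal A$ are multiplicity-free, $\{E_i\}_{i=0}^d$ (resp. $\{E^*_i\}_{i=0}^d$) is an ordering of the primitive idempotents of $A$ (resp. $A^*$), and for $0\le i,j\le d$ each of $E_iA^*E_j$, $E_i^*AE_j^*$ is zero if $|i-j|>1$ and nonzero if $|i-j|=1$. Let $\theta_i$ (resp. $\theta_i^*$) be the eigenvalue of $A$ (resp. $A^*$) associated with $E_i$ (resp. $E_i^*$). For $0\le i\le d$ put $$\tau_i=(\lambda-\theta_0)(\lambda-\theta_1)\cdots(\lambda-\theta_{i-1}),\qquad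 \eta_i=(\lambda-\theta_d)(\lambda-\theta_{d-1})\cdots(\lambda-\theta_{d-i+1}),$$ and for $1\le i\le d$ put $$\varphi_i=(\theta_0^*-\theta_i^*)\frac{\mathrm{tr}(\tau_i(A)E_0^*)}{\mathrm{tr}(\tau_{i-1}(A)E_0^*)},\qquad \phi_i=(\theta_0^*-\theta_i^*)\frac{\mathrm{tr}(\eta_i(A)E_0^*)}{\mathrm{tr}(\eta_{i-1}(A)E_0^*)},$$ where $\mathrm{tr}$ is the trace of the action on $V$. The switching element of $\Phi$ is $$S=\sum_{r=0}^d\frac{\phi_d\phi_{d-1}\cdots\phi_{d-r+1}}{\varphi_1\varphi_2\cdots\varphi_r}E_r .$$ Let $p_d\in\mathbb K[\lambda]$ be the monic polynomial of degree $d$ with $p_d(A)E_0^*V=E_d^*V$, and put $u_d=p_d/p_d(\theta_0)$. Then these objects are well defined: the denominators $\mathrm{tr}(\tau_{i-1}(A)E_0^*)$, $\mathrm{tr}(\eta_{i-1}(A)E_0^*)$ and the scalars $\varphi_i$ are nonzero for $1\le i\le d$, the polynomial $p_d$ exists and is unique, and $p_d(\theta_0)\neq 0$. Moreover $$S=u_d(A).$$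 -/

import Mathlib

open Polynomial

/-- An element `A` of a `K`-algebra isomorphic to `Mat_{d+1}(K)` is multiplicity-free when it has
`d + 1` mutually distinct eigenvalues in `K`. -/
def IsMultiplicityFree (K : Type*) {𝒜 : Type*} [Field K] [Ring 𝒜] [Algebra K 𝒜] (d : ℕ)
    (A : 𝒜) : Prop :=
  (spectrum K A).ncard = d + 1

/-- `θ` is an ordering of the eigenvalues of `A`, and `E i` is the primitive idempotent of `A`
associated with `θ i`, i.e. `E i = ∏_{j ≠ i} (A - θ j I) / (θ i - θ j)` for every `i`.
(`Lagrange.basis` is the polynomial `∏_{j ≠ i} (X - θ j) / (θ i - θ j)`.) -/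
def IsEigenvalueSequence {K 𝒜 : Type*} [Field K] [Ring 𝒜] [Algebra K 𝒜] {d : ℕ}
    (A : 𝒜) (E : Fin (d + 1) → 𝒜) (θ : Fin (d + 1) → K) : Prop :=
  Function.Injective θ ∧ Set.range θ = spectrum K A ∧
    ∀ i, E i = aeval A (Lagrange.basis Finset.univ θ i)

/-- A Leonard system `(A; {E_i}; A*; {E*_i})` in the `K`-algebra `𝒜` (which is meant to be
isomorphic to `Mat_{d+1}(K)`). -/
structure LeonardSystem (K 𝒜 : Type*) [Field K] [Ring 𝒜] [Algebra K 𝒜] (d : ℕ) where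
  A : 𝒜
  E : Fin (d + 1) → 𝒜
  Astar : 𝒜
  Estar : Fin (d + 1) → 𝒜
  multiplicityFree : IsMultiplicityFree K d A
  multiplicityFree_star : IsMultiplicityFree K d Astar
  /-- `E` is an ordering of the primitive idempotents of `A`. -/
  primitive : ∃ θ : Fin (d + 1) → K, IsEigenvalueSequence A E θ
  /-- `Estar` is an ordering of the primitive idempotents of `Astar`. -/
  primitive_star : ∃ θ : Fin (d + 1) → K, IsEigenvalueSequence Astar Estar θ
  tridiagonal_star : ∀ i j : Fin (d + 1),
    (1 < |(i : ℤ) - (j : ℤ)| → E i * Astar * E j = 0) ∧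
    (|(i : ℤ) - (j : ℤ)| = 1 → E i * Astar * E j ≠ 0)
  tridiagonal : ∀ i j : Fin (d + 1),
    (1 < |(i : ℤ) - (j : ℤ)| → Estar i * A * Estar j = 0) ∧
    (|(i : ℤ) - (j : ℤ)| = 1 → Estar i * A * Estar j ≠ 0)

namespace LeonardSystem

noncomputable section

/-- The eigenvalue sequence: `Φ.θ i` is the eigenvalue of `A` associated with `E i`. -/
def θ {K 𝒜 : Type*} [Field K] [Ring 𝒜] [Algebra K 𝒜] {d : ℕ} (Φ : LeonardSystem K 𝒜 d) :
    Fin (d + 1) → K :=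
  Classical.choose Φ.primitive

/-- The dual eigenvalue sequence: `Φ.θstar i` is the eigenvalue of `A*` associated with
`E*_i`. -/
def θstar {K 𝒜 : Type*} [Field K] [Ring 𝒜] [Algebra K 𝒜] {d : ℕ}
    (Φ : LeonardSystem K 𝒜 d) : Fin (d + 1) → K :=
  Classical.choose Φ.primitive_star

/-- `τ_i = (λ - θ_0)(λ - θ_1) ⋯ (λ - θ_{i-1})`. -/
def tau {K 𝒜 : Type*} [Field K] [Ring 𝒜] [Algebra K 𝒜] {d : ℕ} (Φ : LeonardSystem K 𝒜 d)
    (i : Fin (d + 1)) : K[X] :=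
  ∏ h ∈ Finset.Iio i, (X - C (Φ.θ h))

/-- `η_i = (λ - θ_d)(λ - θ_{d-1}) ⋯ (λ - θ_{d-i+1})`; here `h.rev` is `d - h`. -/
def eta {K 𝒜 : Type*} [Field K] [Ring 𝒜] [Algebra K 𝒜] {d : ℕ} (Φ : LeonardSystem K 𝒜 d)
    (i : Fin (d + 1)) : K[X] :=
  ∏ h ∈ Finset.Iio i, (X - C (Φ.θ h.rev))

/-- The trace of an element of `𝒜`, that is, the trace of its action on `V`
(`V` is meant to be the simple left `𝒜`-module). -/
def tr (K : Type*) {𝒜 : Type*} (V : Type*) [Field K] [Ring 𝒜] [Algebra K 𝒜] [AddCommGroup V]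
    [Module K V] [Module 𝒜 V] [IsScalarTower K 𝒜 V] (x : 𝒜) : K :=
  LinearMap.trace K V (Algebra.lsmul K K V x)

/-- The subspace `xV` of `V`. -/
def image (K : Type*) {𝒜 : Type*} (V : Type*) [Field K] [Ring 𝒜] [Algebra K 𝒜]
    [AddCommGroup V] [Module K V] [Module 𝒜 V] [IsScalarTower K 𝒜 V] (x : 𝒜) :
    Submodule K V :=
  LinearMap.range (Algebra.lsmul K K V x)

/-- The first split sequence `φ_1, …, φ_d` (curly phi), shifted to start at `0`: for `i = 0, …, d - 1`,
`Φ.firstSplit V i` is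
`φ_{i+1} = (θ*_0 - θ*_{i+1}) tr(τ_{i+1}(A) E*_0) / tr(τ_i(A) E*_0)`. -/
def firstSplit {K 𝒜 : Type*} (V : Type*) [Field K] [Ring 𝒜] [Algebra K 𝒜] [AddCommGroup V]
    [Module K V] [Module 𝒜 V] [IsScalarTower K 𝒜 V] {d : ℕ} (Φ : LeonardSystem K 𝒜 d)
    (i : Fin d) : K :=
  (Φ.θstar 0 - Φ.θstar i.succ) *
    (tr K V (aeval Φ.A (Φ.tau i.succ) * Φ.Estar 0) /
      tr K V (aeval Φ.A (Φ.tau i.castSucc) * Φ.Estar 0))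

/-- The second split sequence `ϕ_1, …, ϕ_d` (straight phi), shifted to start at `0`: for `i = 0, …, d - 1`,
`Φ.secondSplit V i` is
`ϕ_{i+1} = (θ*_0 - θ*_{i+1}) tr(η_{i+1}(A) E*_0) / tr(η_i(A) E*_0)`. -/
def secondSplit {K 𝒜 : Type*} (V : Type*) [Field K] [Ring 𝒜] [Algebra K 𝒜] [AddCommGroup V]
    [Module K V] [Module 𝒜 V] [IsScalarTower K 𝒜 V] {d : ℕ} (Φ : LeonardSystem K 𝒜 d)
    (i : Fin d) : K :=
  (Φ.θstar 0 - Φ.θstar i.succ) *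
    (tr K V (aeval Φ.A (Φ.eta i.succ) * Φ.Estar 0) /
      tr K V (aeval Φ.A (Φ.eta i.castSucc) * Φ.Estar 0))

/-- The switching element
`S = ∑_{r=0}^d (ϕ_d ϕ_{d-1} ⋯ ϕ_{d-r+1}) / (φ_1 φ_2 ⋯ φ_r) E_r`.
Because of the shift, `ϕ_{d-h}` is `Φ.secondSplit V h.rev` and `φ_{h+1}` is
`Φ.firstSplit V h`, for `h = 0, …, d - 1`. -/
def switchingElement {K 𝒜 : Type*} (V : Type*) [Field K] [Ring 𝒜] [Algebra K 𝒜]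
    [AddCommGroup V] [Module K V] [Module 𝒜 V] [IsScalarTower K 𝒜 V] {d : ℕ}
    (Φ : LeonardSystem K 𝒜 d) : 𝒜 :=
  ∑ r : Fin (d + 1),
    ((∏ h ∈ Finset.univ.filter (fun h : Fin d => h.castSucc < r), Φ.secondSplit V h.rev) /
      (∏ h ∈ Finset.univ.filter (fun h : Fin d => h.castSucc < r), Φ.firstSplit V h)) • Φ.E r

/-- `q` is a monic polynomial of degree `i` with `q(A) E*_0 V = E*_i V`. -/
def IsMonicPoly {K 𝒜 : Type*} (V : Type*) [Field K] [Ring 𝒜] [Algebra K 𝒜]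
    [AddCommGroup V] [Module K V] [Module 𝒜 V] [IsScalarTower K 𝒜 V] {d : ℕ}
    (Φ : LeonardSystem K 𝒜 d) (i : Fin (d + 1)) (q : K[X]) : Prop :=
  q.Monic ∧ q.natDegree = (i : ℕ) ∧
    image K V (aeval Φ.A q * Φ.Estar 0) = image K V (Φ.Estar i)

/-- The monic polynomial `p_i` of degree `i` with `p_i(A) E*_0 V = E*_i V`. -/
def p {K 𝒜 : Type*} (V : Type*) [Field K] [Ring 𝒜] [Algebra K 𝒜] [AddCommGroup V]
    [Module K V] [Module 𝒜 V] [IsScalarTower K 𝒜 V] {d : ℕ} (Φ : LeonardSystem K 𝒜 d)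
    (i : Fin (d + 1)) : K[X] :=
  Classical.epsilon (Φ.IsMonicPoly V i)

/-- `u_i = p_i / p_i(θ_0)`. -/
def u {K 𝒜 : Type*} (V : Type*) [Field K] [Ring 𝒜] [Algebra K 𝒜] [AddCommGroup V]
    [Module K V] [Module 𝒜 V] [IsScalarTower K 𝒜 V] {d : ℕ} (Φ : LeonardSystem K 𝒜 d)
    (i : Fin (d + 1)) : K[X] :=
  C ((Φ.p V i).eval (Φ.θ 0))⁻¹ * Φ.p V i

end

end LeonardSystem

open scoped Matrix

/-! Let `e` and `f` be eigenbases of `A` and `A*` in `V`. Both sides of the identity are diagonal in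
`e`. Since `p_d(A) f_0 = g f_d` with `g ≠ 0`, and `f_0` has no zero coordinate in `e`, the value
`p_d(θ_r)` is `g` times the ratio of the `e_r`-coordinates of `f_d` and `f_0`. It remains to see
that this ratio is multiplied by `ϕ_{d-r} / φ_{r+1}` when `r` grows by one (`repr_f_last_succ`).

The vectors `τ_i(A) f_0` form a split basis: `A* - θ*_{i+1}` sends `τ_{i+1}(A) f_0` to a multiple of
`τ_i(A) f_0` (`exists_split`), and the `f_0`-coordinate shows that the multiplier is `φ_{i+1}`. The
`e_i`-coordinate of the same relation ties `φ_{i+1}` to consecutive coordinates of `f_0`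
(`repr_split`).

Reversing `f` gives such a relation for `f_d`, with the same entry of `A*` and the same values of
`τ`, which cancel in the quotient. The first split sequence of the reversed system is `ϕ_d, …, ϕ_1`
(`splitScalar_reverse_f`), by a duality between the vectors `η_k(A) f_0` and the functionals
"`f_d`-coordinate of `τ_j(A) x`". -/

/-- `τ_i = (X - θ_0) ⋯ (X - θ_{i-1})`. -/
noncomputable def newtonPoly {K : Type*} [Field K] {d : ℕ} (θ : Fin (d + 1) → K)
    (i : Fin (d + 1)) : K[X] :=
  ∏ h ∈ Finset.Iio i, (X - C (θ h))

/-! ### Newton polynomials -/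

section NewtonPoly

variable {K : Type*} [Field K] {d : ℕ} (θ : Fin (d + 1) → K)

theorem newtonPoly_monic (i : Fin (d + 1)) : (newtonPoly θ i).Monic :=
  monic_prod_X_sub_C _ _

theorem newtonPoly_natDegree (i : Fin (d + 1)) : (newtonPoly θ i).natDegree = i := by
  rw [newtonPoly, natDegree_finsetProd_X_sub_C_eq_card, Fin.card_Iio]

theorem newtonPoly_zero : newtonPoly θ 0 = 1 := by
  have : Finset.Iio (0 : Fin (d + 1)) = ∅ := by ext; simp
  rw [newtonPoly, this, Finset.prod_empty]

theorem eval_newtonPoly_of_lt {i j : Fin (d + 1)} (h : j < i) :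
    (newtonPoly θ i).eval (θ j) = 0 := by
  rw [newtonPoly, eval_prod]
  exact Finset.prod_eq_zero (Finset.mem_Iio.2 h) (by simp)

theorem eval_newtonPoly_self_ne_zero {θ : Fin (d + 1) → K} (hθ : Function.Injective θ)
    (i : Fin (d + 1)) : (newtonPoly θ i).eval (θ i) ≠ 0 := by
  rw [newtonPoly, eval_prod]
  refine Finset.prod_ne_zero_iff.2 fun h hh => ?_
  rw [eval_sub, eval_X, eval_C, sub_ne_zero]
  exact fun e => (Finset.mem_Iio.1 hh).ne' (hθ e)

theorem natDegree_newtonPoly_mul (θ' : Fin (d + 1) → K) (i k : Fin (d + 1)) :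
    (newtonPoly θ i * newtonPoly θ' k).natDegree = i + k := by
  rw [(newtonPoly_monic θ i).natDegree_mul (newtonPoly_monic θ' k), newtonPoly_natDegree,
    newtonPoly_natDegree]

end NewtonPoly

/-- `e` and `f` are eigenbases of `A` and `B`, with distinct eigenvalues `θ` and `θ'`, such that
`B` is irreducible tridiagonal with respect to `e` and `A` is irreducible tridiagonal with respect
to `f`. -/
structure IsLeonardBases {K V : Type*} [Field K] [AddCommGroup V] [Module K V] {d : ℕ}
    (A B : Module.End K V) (e f : Module.Basis (Fin (d + 1)) K V) (θ θ' : Fin (d + 1) → K) :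
    Prop where
  inj : Function.Injective θ
  inj' : Function.Injective θ'
  apply_e : ∀ i, A (e i) = θ i • e i
  apply_f : ∀ i, B (f i) = θ' i • f i
  far : ∀ i j : Fin (d + 1), 1 < |(i : ℤ) - (j : ℤ)| → e.repr (B (e j)) i = 0
  near : ∀ i j : Fin (d + 1), |(i : ℤ) - (j : ℤ)| = 1 → e.repr (B (e j)) i ≠ 0
  far' : ∀ i j : Fin (d + 1), 1 < |(i : ℤ) - (j : ℤ)| → f.repr (A (f j)) i = 0
  near' : ∀ i j : Fin (d + 1), |(i : ℤ) - (j : ℤ)| = 1 → f.repr (A (f j)) i ≠ 0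

/-! ### Coordinates with respect to an eigenbasis -/

section Coordinates

variable {K V : Type*} [Field K] [AddCommGroup V] [Module K V] {ι : Type*} [Fintype ι]

theorem Module.Basis.repr_apply_eq_sum (e : Module.Basis ι K V) (B : Module.End K V) (x : V)
    (i : ι) : e.repr (B x) i = ∑ j, e.repr x j * e.repr (B (e j)) i := by
  conv_lhs => rw [← e.sum_repr x]
  simp only [map_sum, map_smul, Finsupp.finsetSum_apply, Finsupp.smul_apply, smul_eq_mul]

theorem Module.Basis.repr_apply_of_eigenbasis {e : Module.Basis ι K V} {A : Module.End K V}
    {θ : ι → K} (h : ∀ i, A (e i) = θ i • e i) (x : V) (i : ι) :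
    e.repr (A x) i = θ i * e.repr x i := by
  classical
  rw [e.repr_apply_eq_sum, Finset.sum_eq_single i]
  · simp [h, mul_comm]
  · intro j _ hj
    simp [h, hj]
  · simp

theorem Module.Basis.repr_aeval_of_eigenbasis {e : Module.Basis ι K V} {A : Module.End K V}
    {θ : ι → K} (h : ∀ i, A (e i) = θ i • e i) (q : K[X]) (x : V) (i : ι) :
    e.repr (aeval A q x) i = q.eval (θ i) * e.repr x i := by
  induction q using Polynomial.induction_on' with
  | add p q hp hq => simp [hp, hq, add_mul]
  | monomial n a =>
    have : e.repr ((A ^ n) x) i = θ i ^ n * e.repr x i := by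
      induction n with
      | zero => simp
      | succ n ih => rw [pow_succ', Module.End.mul_apply, repr_apply_of_eigenbasis h, ih]; ring
    rw [aeval_monomial, eval_monomial, Module.End.mul_apply, Module.algebraMap_end_apply,
      map_smul, Finsupp.smul_apply, this, smul_eq_mul, mul_assoc]

end Coordinates

/-! ### Symmetries, cyclicity of `f 0`, and the split relation -/

namespace IsLeonardBases

variable {K V : Type*} [Field K] [AddCommGroup V] [Module K V] {d : ℕ}
  {A B : Module.End K V} {e f : Module.Basis (Fin (d + 1)) K V} {θ θ' : Fin (d + 1) → K}

/-- Reversing `θ` turns `τ_i` into `η_i`, so facts about the first split sequence transfer to the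
second. -/
theorem reverse_e (L : IsLeonardBases A B e f θ θ') :
    IsLeonardBases A B (e.reindex Fin.revPerm) f (θ ∘ Fin.rev) θ' where
  inj := L.inj.comp Fin.rev_injective
  inj' := L.inj'
  apply_e i := by simpa using L.apply_e i.rev
  apply_f := L.apply_f
  far i j h := by
    simpa using L.far i.rev j.rev (by rw [abs_sub_comm] at h; convert h using 2; grind)
  near i j h := by
    simpa using L.near i.rev j.rev (by rw [abs_sub_comm] at h; rw [← h]; congr 1; grind)
  far' := L.far'
  near' := L.near'

theorem symm (L : IsLeonardBases A B e f θ θ') : IsLeonardBases B A f e θ' θ :=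
  ⟨L.inj', L.inj, L.apply_f, L.apply_e, L.far', L.near', L.far, L.near⟩

/-- Here `f (Fin.last d)` takes over the role of `f 0`. -/
theorem reverse_f (L : IsLeonardBases A B e f θ θ') :
    IsLeonardBases A B e (f.reindex Fin.revPerm) θ (θ' ∘ Fin.rev) :=
  L.symm.reverse_e.symm

/-- Each application of `A` raises the top `f`-index by exactly one, because the subdiagonal entries
are nonzero. -/
theorem repr_pow_apply (L : IsLeonardBases A B e f θ θ') (n : ℕ) :
    (∀ j : Fin (d + 1), n < j → f.repr ((A ^ n) (f 0)) j = 0) ∧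
      ∀ j : Fin (d + 1), n = j → f.repr ((A ^ n) (f 0)) j ≠ 0 := by
  induction n with
  | zero =>
    refine ⟨fun j hj => ?_, fun j hj => ?_⟩
    · have : (0 : Fin (d + 1)) ≠ j := by rintro rfl; simp at hj
      simp [this]
    · obtain rfl : j = 0 := Fin.ext hj.symm
      simp
  | succ n ih =>
    refine ⟨fun j hj => ?_, fun j hj => ?_⟩
    · rw [pow_succ', Module.End.mul_apply, f.repr_apply_eq_sum]
      refine Finset.sum_eq_zero fun k _ => ?_
      by_cases hk : n < k
      · rw [ih.1 k hk, zero_mul]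
      · rw [L.far' j k (by rw [lt_abs]; omega), mul_zero]
    · rw [pow_succ', Module.End.mul_apply, f.repr_apply_eq_sum,
        Finset.sum_eq_single (⟨n, by omega⟩ : Fin (d + 1))]
      · exact mul_ne_zero (ih.2 _ rfl) (L.near' _ _ (by rw [← hj]; simp))
      · intro k _ hk
        have hk' : (k : ℕ) ≠ n := fun h => hk (Fin.ext h)
        by_cases hk : n < k
        · rw [ih.1 k hk, zero_mul]
        · rw [L.far' j k (by rw [lt_abs]; omega), mul_zero]
      · simp

theorem repr_aeval_apply_f_zero (L : IsLeonardBases A B e f θ θ') (q : K[X]) (j : Fin (d + 1))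
    (hq : q.natDegree ≤ j) :
    f.repr (aeval A q (f 0)) j = q.coeff j * f.repr ((A ^ (j : ℕ)) (f 0)) j := by
  rw [aeval_eq_sum_range' (Nat.lt_succ_of_le hq), LinearMap.sum_apply, map_sum,
    Finsupp.finsetSum_apply, Finset.sum_range_succ, Finset.sum_eq_zero, zero_add]
  · simp
  · intro n hn
    simp [(L.repr_pow_apply n).1 j (Finset.mem_range.1 hn)]

theorem repr_pow_self_ne_zero (L : IsLeonardBases A B e f θ θ') (j : Fin (d + 1)) :
    f.repr ((A ^ (j : ℕ)) (f 0)) j ≠ 0 :=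
  (L.repr_pow_apply j).2 j rfl

theorem repr_aeval (L : IsLeonardBases A B e f θ θ') (q : K[X]) (x : V) (j : Fin (d + 1)) :
    e.repr (aeval A q x) j = q.eval (θ j) * e.repr x j :=
  Module.Basis.repr_aeval_of_eigenbasis L.apply_e q x j

theorem aeval_apply_eq_zero (L : IsLeonardBases A B e f θ θ') {q : K[X]} {x : V}
    (h : ∀ j, q.eval (θ j) * e.repr x j = 0) : aeval A q x = 0 := by
  apply e.repr.injective
  ext j
  simp [L.repr_aeval, h]

/-- Were the coordinate zero, the product of the `d` factors `A - θ_k`, `k ≠ j`, would kill `f 0`;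
but a monic polynomial of degree `d` in `A` gives `f 0` a nonzero last `f`-coordinate. -/
theorem repr_f_zero_ne_zero (L : IsLeonardBases A B e f θ θ') (j : Fin (d + 1)) :
    e.repr (f 0) j ≠ 0 := by
  intro hj
  let q : K[X] := ∏ k ∈ Finset.univ.erase j, (X - C (θ k))
  have hq : q.natDegree = d := by
    simp [q, natDegree_finsetProd_X_sub_C_eq_card]
  have h0 : aeval A q (f 0) = 0 := by
    refine L.aeval_apply_eq_zero fun k => ?_
    by_cases hk : k = j
    · rw [hk, hj, mul_zero]
    · rw [eval_prod, Finset.prod_eq_zero (Finset.mem_erase.2 ⟨hk, Finset.mem_univ k⟩) (by simp),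
        zero_mul]
  have h1 := L.repr_aeval_apply_f_zero q (Fin.last d) (by simp [hq])
  have hm : q.coeff d = 1 := by
    rw [← hq]; exact monic_prod_X_sub_C _ _
  rw [h0, Fin.val_last, hm, one_mul] at h1
  exact L.repr_pow_self_ne_zero (Fin.last d) (by simpa using h1.symm)

theorem exists_aeval_eq (L : IsLeonardBases A B e f θ θ') (x : V) :
    ∃ q : K[X], q.natDegree ≤ d ∧ aeval A q (f 0) = x := by
  let q := Lagrange.interpolate Finset.univ θ fun j => e.repr x j / e.repr (f 0) j
  refine ⟨q, ?_, ?_⟩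
  · have := Lagrange.degree_interpolate_lt (s := Finset.univ)
      (fun j => e.repr x j / e.repr (f 0) j) L.inj.injOn
    rw [Finset.card_univ, Fintype.card_fin] at this
    exact natDegree_le_iff_coeff_eq_zero.2 fun n hn => (degree_lt_iff_coeff_zero _ _).1 this n hn
  · apply e.repr.injective
    ext j
    rw [L.repr_aeval, Lagrange.eval_interpolate_at_node _ L.inj.injOn (Finset.mem_univ j),
      div_mul_cancel₀ _ (L.repr_f_zero_ne_zero j)]

theorem exists_aeval_eq_of_repr_eq_zero (L : IsLeonardBases A B e f θ θ') {x : V} {i : ℕ}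
    (hx : ∀ k : Fin (d + 1), i < k → f.repr x k = 0) :
    ∃ q : K[X], q.natDegree ≤ i ∧ aeval A q (f 0) = x := by
  obtain ⟨q, hq, rfl⟩ := L.exists_aeval_eq x
  refine ⟨q, ?_, rfl⟩
  by_contra! h
  have h1 := hx ⟨q.natDegree, by omega⟩ h
  rw [L.repr_aeval_apply_f_zero q _ le_rfl] at h1
  rcases mul_eq_zero.1 h1 with h2 | h2
  · rw [coeff_natDegree, leadingCoeff_eq_zero] at h2
    simp [h2] at h
  · exact L.repr_pow_self_ne_zero _ h2

/-- `B` lowers the `e`-index by at most one, so only `e i.succ` can contribute at the new lowest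
index. -/
theorem repr_apply_of_repr_eq_zero (L : IsLeonardBases A B e f θ θ') (i : Fin d) {w : V}
    (hw : ∀ k, k < i.succ → e.repr w k = 0) :
    (∀ j, j < i.castSucc → e.repr (B w) j = 0) ∧
      e.repr (B w) i.castSucc = e.repr w i.succ * e.repr (B (e i.succ)) i.castSucc := by
  constructor
  · intro j hj
    rw [e.repr_apply_eq_sum]
    refine Finset.sum_eq_zero fun k _ => ?_
    by_cases hk : k < i.succ
    · rw [hw k hk, zero_mul]
    · rw [L.far j k, mul_zero]
      rw [Fin.lt_def, Fin.val_succ] at hk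
      rw [Fin.lt_def, Fin.val_castSucc] at hj
      rw [lt_abs]; omega
  · rw [e.repr_apply_eq_sum, Finset.sum_eq_single i.succ]
    · intro k _ hk'
      by_cases hk : k < i.succ
      · rw [hw k hk, zero_mul]
      · rw [L.far _ k, mul_zero]
        rw [Fin.lt_def, Fin.val_succ] at hk
        rw [Ne, Fin.ext_iff, Fin.val_succ] at hk'
        rw [Fin.val_castSucc, lt_abs]; omega
    · simp

/-- The vector `τ_{i+1}(A) f_0` lies in the span of `f_0, …, f_{i+1}` and in that of `e_{i+1}, …,
e_d`. Applying `B - θ'_{i+1}` removes `f_{i+1}` and adds at most `e_i`. The result is `q(A) f_0`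
with `deg q ≤ i` and roots `θ_0, …, θ_{i-1}`, so `q` is a multiple of `τ_i`. -/
theorem exists_split (L : IsLeonardBases A B e f θ θ') (i : Fin d) :
    ∃ c : K, B (aeval A (newtonPoly θ i.succ) (f 0)) =
      θ' i.succ • aeval A (newtonPoly θ i.succ) (f 0) +
        c • aeval A (newtonPoly θ i.castSucc) (f 0) := by
  set w := aeval A (newtonPoly θ i.succ) (f 0) with hw
  have hwe : ∀ k, k < i.succ → e.repr w k = 0 := fun k hk => by
    rw [hw, L.repr_aeval, eval_newtonPoly_of_lt θ hk, zero_mul]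
  have hx : ∀ k : Fin (d + 1), (i : ℕ) < k → f.repr (B w - θ' i.succ • w) k = 0 := by
    intro k hk
    rw [map_sub, map_smul, Finsupp.sub_apply, Finsupp.smul_apply,
      Module.Basis.repr_apply_of_eigenbasis L.apply_f, smul_eq_mul, ← sub_mul]
    rcases eq_or_ne k i.succ with rfl | hk'
    · rw [sub_self, zero_mul]
    · rw [Ne, Fin.ext_iff, Fin.val_succ] at hk'
      rw [hw, L.repr_aeval_apply_f_zero _ k (by rw [newtonPoly_natDegree, Fin.val_succ]; omega),
        coeff_eq_zero_of_natDegree_lt (by rw [newtonPoly_natDegree, Fin.val_succ]; omega),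
        zero_mul, mul_zero]
  obtain ⟨q, hq, hqx⟩ := L.exists_aeval_eq_of_repr_eq_zero hx
  refine ⟨q.coeff i, ?_⟩
  have hroot : ∀ j, j < i.castSucc → q.eval (θ j) = 0 := by
    intro j hj
    have := L.repr_aeval q (f 0) j
    rw [hqx, map_sub, map_smul, Finsupp.sub_apply, Finsupp.smul_apply,
      hwe j (hj.trans (Fin.castSucc_lt_succ)), (L.repr_apply_of_repr_eq_zero i hwe).1 j hj,
      smul_zero, sub_zero] at this
    exact (mul_eq_zero.1 this.symm).resolve_right (L.repr_f_zero_ne_zero j)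
  -- The coefficients of degree `i` agree, so the difference has degree below `i` and vanishes at
  -- `i` distinct points.
  have hq' : q = q.coeff i • newtonPoly θ i.castSucc := by
    rw [← sub_eq_zero]
    refine eq_zero_of_degree_lt_of_eval_index_eq_zero (Finset.Iio i.castSucc) (v := θ)
      L.inj.injOn ?_ fun j hj => ?_
    · rw [Fin.card_Iio, Fin.val_castSucc, degree_lt_iff_coeff_zero]
      intro m hm
      have hdeg := newtonPoly_natDegree θ i.castSucc
      rw [Fin.val_castSucc] at hdeg
      rcases hm.eq_or_lt with rfl | hm
      · have : (newtonPoly θ i.castSucc).coeff i = 1 := by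
          conv_lhs => rw [← hdeg]
          exact newtonPoly_monic θ _
        simp [this]
      · rw [coeff_sub, coeff_smul, coeff_eq_zero_of_natDegree_lt (hq.trans_lt hm),
          coeff_eq_zero_of_natDegree_lt (hdeg.trans_lt hm), smul_zero, sub_zero]
    · have hj := Finset.mem_Iio.1 hj
      rw [eval_sub, eval_smul, hroot j hj, eval_newtonPoly_of_lt θ hj, smul_zero, sub_zero]
  rw [← sub_eq_iff_eq_add', ← hqx]
  conv_lhs => rw [hq']
  rw [map_smul, LinearMap.smul_apply]

end IsLeonardBases

/-! ### Split scalars and their behaviour under reversal -/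

/-- The scalars `(θ'_0 - θ'_{i+1}) t_{i+1} / t_i`, where `t_i` is the coordinate of `τ_i(A) f_0`
at `f_0`. -/
noncomputable def splitScalar {K V : Type*} [Field K] [AddCommGroup V] [Module K V] {d : ℕ}
    (A : Module.End K V) (f : Module.Basis (Fin (d + 1)) K V) (θ θ' : Fin (d + 1) → K)
    (i : Fin d) : K :=
  (θ' 0 - θ' i.succ) * (f.repr (aeval A (newtonPoly θ i.succ) (f 0)) 0 /
    f.repr (aeval A (newtonPoly θ i.castSucc) (f 0)) 0)

namespace IsLeonardBases

variable {K V : Type*} [Field K] [AddCommGroup V] [Module K V] {d : ℕ}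
  {A B : Module.End K V} {e f : Module.Basis (Fin (d + 1)) K V} {θ θ' : Fin (d + 1) → K}

theorem repr_split (L : IsLeonardBases A B e f θ θ') (i : Fin d) {c : K}
    (hc : B (aeval A (newtonPoly θ i.succ) (f 0)) =
      θ' i.succ • aeval A (newtonPoly θ i.succ) (f 0) +
        c • aeval A (newtonPoly θ i.castSucc) (f 0)) :
    c * ((newtonPoly θ i.castSucc).eval (θ i.castSucc) * e.repr (f 0) i.castSucc) =
      e.repr (B (e i.succ)) i.castSucc *
        ((newtonPoly θ i.succ).eval (θ i.succ) * e.repr (f 0) i.succ) := by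
  have hwe : ∀ k, k < i.succ → e.repr (aeval A (newtonPoly θ i.succ) (f 0)) k = 0 :=
    fun k hk => by rw [L.repr_aeval, eval_newtonPoly_of_lt θ hk, zero_mul]
  have h1 := (L.repr_apply_of_repr_eq_zero i hwe).2
  rw [hc, map_add, map_smul, map_smul, Finsupp.add_apply, Finsupp.smul_apply, Finsupp.smul_apply,
    hwe _ Fin.castSucc_lt_succ, smul_zero, zero_add, L.repr_aeval, L.repr_aeval,
    smul_eq_mul] at h1
  rw [h1, mul_comm]

/-- Nonvanishing comes from the `e`-coordinate of the split relation, the formula from its `f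
0`-coordinate, on which `B` acts by `θ' 0`. -/
theorem coord_zero_ne_zero_and_split (L : IsLeonardBases A B e f θ θ') (i : Fin d) {c : K}
    (hc : B (aeval A (newtonPoly θ i.succ) (f 0)) =
      θ' i.succ • aeval A (newtonPoly θ i.succ) (f 0) +
        c • aeval A (newtonPoly θ i.castSucc) (f 0)) :
    c ≠ 0 ∧ (θ' 0 - θ' i.succ) * f.repr (aeval A (newtonPoly θ i.succ) (f 0)) 0 =
      c * f.repr (aeval A (newtonPoly θ i.castSucc) (f 0)) 0 := by
  constructor
  · rintro rfl
    have h := L.repr_split i hc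
    rw [zero_mul] at h
    exact mul_ne_zero (L.near _ _ (by simp)) (mul_ne_zero (eval_newtonPoly_self_ne_zero L.inj _)
      (L.repr_f_zero_ne_zero _)) h.symm
  · have h := congrArg (fun x => f.repr x 0) hc
    simp only [Module.Basis.repr_apply_of_eigenbasis L.apply_f, map_add, map_smul,
      Finsupp.add_apply, Finsupp.smul_apply, smul_eq_mul] at h
    rw [sub_mul, h]; ring

theorem coord_zero_ne_zero (L : IsLeonardBases A B e f θ θ') (i : Fin (d + 1)) :
    f.repr (aeval A (newtonPoly θ i) (f 0)) 0 ≠ 0 := by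
  induction i using Fin.induction with
  | zero => simp [newtonPoly_zero]
  | succ i ih =>
    obtain ⟨c, hc⟩ := L.exists_split i
    obtain ⟨h0, h1⟩ := L.coord_zero_ne_zero_and_split i hc
    exact right_ne_zero_of_mul (h1 ▸ mul_ne_zero h0 ih)

theorem apply_newtonPoly_succ (L : IsLeonardBases A B e f θ θ') (i : Fin d) :
    B (aeval A (newtonPoly θ i.succ) (f 0)) =
      θ' i.succ • aeval A (newtonPoly θ i.succ) (f 0) +
        splitScalar A f θ θ' i • aeval A (newtonPoly θ i.castSucc) (f 0) := by
  obtain ⟨c, hc⟩ := L.exists_split i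
  have h := (L.coord_zero_ne_zero_and_split i hc).2
  have : splitScalar A f θ θ' i = c := by
    rw [splitScalar, ← mul_div_assoc, h, mul_div_cancel_right₀ _ (L.coord_zero_ne_zero _)]
  rw [this, hc]

theorem splitScalar_ne_zero (L : IsLeonardBases A B e f θ θ') (i : Fin d) :
    splitScalar A f θ θ' i ≠ 0 :=
  (L.coord_zero_ne_zero_and_split i (L.apply_newtonPoly_succ i)).1

theorem splitScalar_mul_coord (L : IsLeonardBases A B e f θ θ') (i : Fin d) :
    (θ' 0 - θ' i.succ) * f.repr (aeval A (newtonPoly θ i.succ) (f 0)) 0 =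
      splitScalar A f θ θ' i * f.repr (aeval A (newtonPoly θ i.castSucc) (f 0)) 0 :=
  (L.coord_zero_ne_zero_and_split i (L.apply_newtonPoly_succ i)).2

/-- The polynomial `τ_i η_k` has degree `i + k`. Below `d` it cannot reach `f_d`; at `d` only the
leading term does; above `d` every `θ_j` is a root. -/
theorem coord_last_newtonPoly_mul (L : IsLeonardBases A B e f θ θ') (i k : Fin (d + 1)) :
    f.repr (aeval A (newtonPoly θ i) (aeval A (newtonPoly (θ ∘ Fin.rev) k) (f 0))) (Fin.last d) =
      if k = i.rev then f.repr ((A ^ d) (f 0)) (Fin.last d) else 0 := by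
  rw [← Module.End.mul_apply, ← map_mul]
  have hdeg := natDegree_newtonPoly_mul θ (θ ∘ Fin.rev) i k
  have hrev := Fin.val_rev i
  rcases lt_trichotomy ((i : ℕ) + k) d with h | h | h
  · have hk : k ≠ i.rev := by rintro rfl; omega
    rw [if_neg hk, L.repr_aeval_apply_f_zero _ _ (by rw [hdeg, Fin.val_last]; omega),
      coeff_eq_zero_of_natDegree_lt (by rw [hdeg, Fin.val_last]; omega), zero_mul]
  · have hk : k = i.rev := Fin.ext (by omega)
    rw [if_pos hk, L.repr_aeval_apply_f_zero _ _ (by rw [hdeg, Fin.val_last]; omega),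
      Fin.val_last]
    have : (newtonPoly θ i * newtonPoly (θ ∘ Fin.rev) k).coeff d = 1 := by
      rw [h] at hdeg
      conv_lhs => arg 2; rw [← hdeg]
      exact (newtonPoly_monic θ i).mul (newtonPoly_monic _ k)
    rw [this, one_mul]
  · have hk : k ≠ i.rev := by rintro rfl; omega
    rw [if_neg hk, L.aeval_apply_eq_zero, map_zero, Finsupp.zero_apply]
    intro j
    rw [eval_mul]
    by_cases hj : j < i
    · rw [eval_newtonPoly_of_lt θ hj, zero_mul, zero_mul]
    · have hj' : j.rev < k := by
        rw [Fin.lt_def, Fin.val_rev]; rw [Fin.lt_def] at hj; omega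
      have := eval_newtonPoly_of_lt (θ ∘ Fin.rev) hj'
      rw [Function.comp_apply, Fin.rev_rev] at this
      rw [this, mul_zero, zero_mul]

theorem linearIndependent_newtonPoly_rev (L : IsLeonardBases A B e f θ θ') :
    LinearIndependent K fun k => aeval A (newtonPoly (θ ∘ Fin.rev) k) (f 0) := by
  rw [Fintype.linearIndependent_iff]
  intro g hg i
  have h := congrArg (fun x => f.repr (aeval A (newtonPoly θ i.rev) x) (Fin.last d)) hg
  simp only [map_sum, map_smul, Finsupp.finsetSum_apply, Finsupp.smul_apply,
    L.coord_last_newtonPoly_mul, Fin.rev_rev, map_zero, Finsupp.zero_apply, smul_eq_mul, mul_ite,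
    mul_zero, Finset.sum_ite_eq', Finset.mem_univ, if_true] at h
  exact (mul_eq_zero.1 h).resolve_right (L.repr_pow_self_ne_zero (Fin.last d))

/-- This is the transpose of the bidiagonal action of `B` on the basis `η_k(A) f_0`, to which the
functionals `T j` are dual up to order and a common factor. -/
theorem coord_last_newtonPoly_apply (L : IsLeonardBases A B e f θ θ') (i : Fin d) (x : V) :
    f.repr (aeval A (newtonPoly θ i.succ) (B x)) (Fin.last d) =
      θ' i.succ.rev * f.repr (aeval A (newtonPoly θ i.succ) x) (Fin.last d) +
        splitScalar A f (θ ∘ Fin.rev) θ' i.rev *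
          f.repr (aeval A (newtonPoly θ i.castSucc) x) (Fin.last d) := by
  let b := basisOfLinearIndependentOfCardEqFinrank L.linearIndependent_newtonPoly_rev
    (Module.finrank_eq_card_basis f).symm
  let T (j : Fin (d + 1)) : V →ₗ[K] K := f.coord (Fin.last d) ∘ₗ aeval A (newtonPoly θ j)
  suffices H : T i.succ ∘ₗ B = θ' i.succ.rev • T i.succ +
      splitScalar A f (θ ∘ Fin.rev) θ' i.rev • T i.castSucc from LinearMap.congr_fun H x
  refine b.ext fun k => ?_
  have hb : b k = aeval A (newtonPoly (θ ∘ Fin.rev) k) (f 0) := by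
    simp [b]
  rw [hb]
  have hT (j k) : T j (aeval A (newtonPoly (θ ∘ Fin.rev) k) (f 0)) =
      if k = j.rev then f.repr ((A ^ d) (f 0)) (Fin.last d) else 0 :=
    L.coord_last_newtonPoly_mul j k
  simp only [LinearMap.comp_apply, LinearMap.add_apply, LinearMap.smul_apply, smul_eq_mul]
  induction k using Fin.cases with
  | zero =>
    have h0 : B (aeval A (newtonPoly (θ ∘ Fin.rev) 0) (f 0)) =
        θ' 0 • aeval A (newtonPoly (θ ∘ Fin.rev) 0) (f 0) := by
      simp [newtonPoly_zero, L.apply_f]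
    rw [h0, map_smul, hT, hT, Fin.rev_castSucc, if_neg (Fin.succ_ne_zero _).symm, mul_zero,
      add_zero, smul_eq_mul]
    split_ifs with h
    · rw [← h]
    · simp
  | succ k =>
    rw [L.reverse_e.apply_newtonPoly_succ k, map_add, map_smul, map_smul, hT, hT, hT,
      Fin.rev_castSucc, Fin.rev_succ]
    simp only [Fin.succ_inj, Fin.castSucc_inj, smul_eq_mul]
    congr 1
    · split_ifs with h
      · rw [h]
      · simp
    · split_ifs with h
      · rw [h]
      · simp

/-- At `x = f_d` the transposed relation becomes the recursion that defines the split scalars of the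
`f`-reversed system. -/
theorem splitScalar_reverse_f (L : IsLeonardBases A B e f θ θ') (i : Fin d) :
    splitScalar A (f.reindex Fin.revPerm) θ (θ' ∘ Fin.rev) i =
      splitScalar A f (θ ∘ Fin.rev) θ' i.rev := by
  have h1 := L.reverse_f.splitScalar_mul_coord i
  have h0 := L.reverse_f.coord_zero_ne_zero i.castSucc
  have h2 := L.coord_last_newtonPoly_apply i (f (Fin.last d))
  rw [L.apply_f, map_smul, map_smul, Finsupp.smul_apply, smul_eq_mul] at h2
  simp only [Module.Basis.repr_reindex_apply, Module.Basis.reindex_apply, Fin.revPerm_symm,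
    Fin.revPerm_apply, Fin.rev_zero, Function.comp_apply] at h1 h0
  refine mul_right_cancel₀ h0 ?_
  rw [← h1, sub_mul, h2]
  ring

theorem repr_f_last_succ (L : IsLeonardBases A B e f θ θ') (i : Fin d) :
    e.repr (f (Fin.last d)) i.succ / e.repr (f 0) i.succ =
      splitScalar A f (θ ∘ Fin.rev) θ' i.rev / splitScalar A f θ θ' i *
        (e.repr (f (Fin.last d)) i.castSucc / e.repr (f 0) i.castSucc) := by
  have h1 := L.repr_split i (L.apply_newtonPoly_succ i)
  have h2 := L.reverse_f.repr_split i (L.reverse_f.apply_newtonPoly_succ i)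
  rw [L.splitScalar_reverse_f] at h2
  simp only [Module.Basis.reindex_apply, Fin.revPerm_symm, Fin.revPerm_apply, Fin.rev_zero] at h2
  have n1 := L.repr_f_zero_ne_zero i.succ
  have n2 := L.repr_f_zero_ne_zero i.castSucc
  have n3 := L.splitScalar_ne_zero i
  have n4 := eval_newtonPoly_self_ne_zero L.inj i.succ
  have n5 := eval_newtonPoly_self_ne_zero L.inj i.castSucc
  have n6 := L.near i.castSucc i.succ (by simp)
  rw [div_mul_div_comm, div_eq_div_iff n1 (mul_ne_zero n3 n2)]
  refine mul_left_cancel₀ (mul_ne_zero (mul_ne_zero n6 n4) n5) ?_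
  linear_combination
    (e.repr (B (e i.succ)) i.castSucc * (newtonPoly θ i.succ).eval (θ i.succ) *
      e.repr (f (Fin.last d)) i.succ) * h1 -
    (e.repr (B (e i.succ)) i.castSucc * (newtonPoly θ i.succ).eval (θ i.succ) *
      e.repr (f 0) i.succ) * h2

end IsLeonardBases

/-! ### The simple module of a matrix algebra -/

section SimpleModule

variable {K 𝒜 V : Type*} [Field K] [Ring 𝒜] [Algebra K 𝒜] [AddCommGroup V]
  [Module K V] [Module 𝒜 V] [IsScalarTower K 𝒜 V]

theorem Algebra.lsmul_apply_eq_smul (a : 𝒜) (x : V) : Algebra.lsmul K K V a x = a • x :=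
  rfl

/-- A simple module over a matrix algebra is isomorphic to the space of column vectors. -/
theorem nonempty_linearEquiv_of_algEquiv_matrix [IsSimpleModule 𝒜 V] {n : Type*} [Fintype n]
    [DecidableEq n] (φ : 𝒜 ≃ₐ[K] Matrix n n K) : Nonempty ((n → K) ≃ₗ[K] V) := by
  have := IsSimpleModule.nontrivial 𝒜 V
  obtain ⟨w, hw⟩ := exists_ne (0 : V)
  obtain ⟨j, hj⟩ : ∃ j, φ.symm (Matrix.single j j 1) • w ≠ 0 := by
    by_contra! h
    apply hw
    rw [← one_smul 𝒜 w, ← map_one φ.symm, ← Matrix.sum_single_one, map_sum, Finset.sum_smul]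
    exact Finset.sum_eq_zero fun j _ => h j
  -- The column space is embedded as the matrices supported in column `j`, acting on `w`; this
  -- commutes with the action of `𝒜`.
  let T : (n → K) →ₗ[K] V :=
    { toFun x := φ.symm (Matrix.vecMulVec x (Pi.single j 1)) • w
      map_add' x y := by rw [Matrix.add_vecMulVec, map_add, add_smul]
      map_smul' c x := by rw [Matrix.smul_vecMulVec, map_smul, smul_assoc, RingHom.id_apply] }
  have hT (a : 𝒜) (x : n → K) : a • T x = T (φ a *ᵥ x) := by
    change a • φ.symm _ • w = φ.symm _ • w
    rw [smul_smul, ← Matrix.mul_vecMulVec, map_mul, AlgEquiv.symm_apply_apply]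
  have hTj : T (Pi.single j 1) ≠ 0 := by
    change φ.symm (Matrix.vecMulVec (Pi.single j 1) (Pi.single j 1)) • w ≠ 0
    rwa [← Matrix.single_eq_single_vecMulVec_single]
  refine ⟨LinearEquiv.ofBijective T ⟨?_, ?_⟩⟩
  · rw [injective_iff_map_eq_zero]
    intro x hx
    ext k
    by_contra hk
    -- The matrix unit isolates the coordinate `x k` and moves it to position `j`, where `T` is
    -- known not to vanish.
    have h := hT (φ.symm (Matrix.single j k 1)) x
    rw [hx, smul_zero, AlgEquiv.apply_symm_apply, Matrix.single_mulVec] at h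
    have h2 : Pi.single j (1 * x k) = x k • (Pi.single j 1 : n → K) := by
      ext i; simp [Pi.single_apply]
    change 0 = T (Pi.single j (1 * x k)) at h
    rw [h2, map_smul, eq_comm, smul_eq_zero] at h
    exact h.elim hk hTj
  · let N : Submodule 𝒜 V :=
      { carrier := Set.range T
        add_mem' := by rintro _ _ ⟨x, rfl⟩ ⟨y, rfl⟩; exact ⟨x + y, map_add _ _ _⟩
        zero_mem' := ⟨0, map_zero _⟩
        smul_mem' := by rintro a _ ⟨x, rfl⟩; exact ⟨φ a *ᵥ x, (hT a x).symm⟩ }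
    rcases eq_bot_or_eq_top N with h | h
    · exact absurd ((Submodule.mem_bot 𝒜).1 (h ▸ (⟨_, rfl⟩ : T (Pi.single j 1) ∈ N))) hTj
    · intro x
      exact (h ▸ Submodule.mem_top : x ∈ N)

/-- Injectivity holds because `𝒜` is a simple ring; surjectivity follows by equality of dimensions.
-/
theorem bijective_lsmul_of_algEquiv_matrix [IsSimpleModule 𝒜 V] {d : ℕ}
    (φ : 𝒜 ≃ₐ[K] Matrix (Fin (d + 1)) (Fin (d + 1)) K) :
    Function.Bijective (Algebra.lsmul K K V : 𝒜 →ₐ[K] Module.End K V) := by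
  obtain ⟨ψ⟩ := nonempty_linearEquiv_of_algEquiv_matrix (V := V) φ
  have := IsSimpleModule.nontrivial 𝒜 V
  have := Module.Finite.equiv ψ
  have := Module.Finite.equiv φ.toLinearEquiv.symm
  have : IsSimpleRing 𝒜 := IsSimpleRing.of_ringEquiv φ.symm.toRingEquiv inferInstance
  have hinj : Function.Injective (Algebra.lsmul K K V : 𝒜 →ₐ[K] Module.End K V) :=
    (Algebra.lsmul K K V : 𝒜 →ₐ[K] Module.End K V).toRingHom.injective
  refine ⟨hinj, ?_⟩
  refine (LinearMap.injective_iff_surjective_of_finrank_eq_finrank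
    (f := (Algebra.lsmul K K V : 𝒜 →ₐ[K] Module.End K V).toLinearMap) ?_).1 hinj
  rw [φ.toLinearEquiv.finrank_eq, Module.finrank_linearMap, ← ψ.finrank_eq]
  simp [Module.finrank_matrix]

/-- The primitive idempotents of a multiplicity-free element are the coordinate projections of an
eigenbasis. -/
theorem IsEigenvalueSequence.exists_basis [FiniteDimensional K V] {d : ℕ} {A : 𝒜}
    {E : Fin (d + 1) → 𝒜} {θ : Fin (d + 1) → K} (h : IsEigenvalueSequence A E θ)
    (hV : Module.finrank K V = d + 1)
    (hρ : Function.Bijective (Algebra.lsmul K K V : 𝒜 →ₐ[K] Module.End K V)) :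
    ∃ e : Module.Basis (Fin (d + 1)) K V, (∀ i, Algebra.lsmul K K V A (e i) = θ i • e i) ∧
      ∀ i x, E i • x = e.repr x i • e i := by
  obtain ⟨hinj, hspec, hE⟩ := h
  have hev (i) : Module.End.HasEigenvalue (Algebra.lsmul K K V A) (θ i) := by
    rw [Module.End.hasEigenvalue_iff_mem_spectrum]
    have := AlgEquiv.spectrum_eq (AlgEquiv.ofBijective _ hρ) A
    rw [AlgEquiv.ofBijective_apply] at this
    rw [this, ← hspec]
    exact ⟨i, rfl⟩
  choose v hv using fun i => (hev i).exists_hasEigenvector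
  have hli := Module.End.eigenvectors_linearIndependent' _ θ hinj v hv
  let e := basisOfLinearIndependentOfCardEqFinrank hli (by simp [hV])
  have he (i) : e i = v i := by simp [e]
  have hA (i) : Algebra.lsmul K K V A (e i) = θ i • e i := by
    rw [he]; exact (hv i).apply_eq_smul
  refine ⟨e, hA, fun i x => ?_⟩
  apply e.repr.injective
  ext k
  have : E i • x = aeval (Algebra.lsmul K K V A) (Lagrange.basis Finset.univ θ i) x := by
    rw [hE, aeval_algHom_apply]; rfl
  rw [this, Module.Basis.repr_aeval_of_eigenbasis hA]
  rcases eq_or_ne i k with rfl | hk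
  · simp [Lagrange.eval_basis_self hinj.injOn]
  · simp [Lagrange.eval_basis_of_ne hk, hk]

end SimpleModule

/-! ### From Leonard systems to pairs of eigenbases -/

namespace LeonardSystem

variable {K 𝒜 V : Type*} [Field K] [Ring 𝒜] [Algebra K 𝒜] [AddCommGroup V]
  [Module K V] [Module 𝒜 V] [IsScalarTower K 𝒜 V] {d : ℕ}

theorem repr_of_projection_mul_mul {e : Module.Basis (Fin (d + 1)) K V} {E : Fin (d + 1) → 𝒜}
    (hE : ∀ i x, E i • x = e.repr x i • e i) (B : 𝒜) (i j : Fin (d + 1)) (x : V) :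
    (E i * B * E j) • x =
      (e.repr x j * e.repr (Algebra.lsmul K K V B (e j)) i) • e i := by
  have h : B • e.repr x j • e j = e.repr x j • Algebra.lsmul K K V B (e j) :=
    map_smul (Algebra.lsmul K K V B) _ _
  rw [mul_smul, mul_smul, hE j, hE i, h, map_smul, Finsupp.smul_apply, smul_eq_mul]

theorem mul_mul_eq_zero_iff {e : Module.Basis (Fin (d + 1)) K V} {E : Fin (d + 1) → 𝒜}
    (hE : ∀ i x, E i • x = e.repr x i • e i)
    (hρ : Function.Injective (Algebra.lsmul K K V : 𝒜 →ₐ[K] Module.End K V))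
    (B : 𝒜) (i j : Fin (d + 1)) :
    E i * B * E j = 0 ↔ e.repr (Algebra.lsmul K K V B (e j)) i = 0 := by
  constructor
  · intro h
    have h1 := repr_of_projection_mul_mul hE B i j (e j)
    rw [h, zero_smul, eq_comm, smul_eq_zero] at h1
    simpa using h1.resolve_right (e.ne_zero i)
  · intro h
    apply hρ
    ext x
    rw [Algebra.lsmul_apply_eq_smul, repr_of_projection_mul_mul hE, h]
    simp

/-- A Leonard system is realized on the simple module by a pair of eigenbases. -/
theorem exists_isLeonardBases (Φ : LeonardSystem K 𝒜 d) [FiniteDimensional K V]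
    (hV : Module.finrank K V = d + 1)
    (hρ : Function.Bijective (Algebra.lsmul K K V : 𝒜 →ₐ[K] Module.End K V)) :
    ∃ e f : Module.Basis (Fin (d + 1)) K V,
      IsLeonardBases (Algebra.lsmul K K V Φ.A) (Algebra.lsmul K K V Φ.Astar) e f Φ.θ Φ.θstar ∧
      (∀ i x, Φ.E i • x = e.repr x i • e i) ∧ ∀ i x, Φ.Estar i • x = f.repr x i • f i := by
  have h : IsEigenvalueSequence Φ.A Φ.E Φ.θ := Classical.choose_spec Φ.primitive
  have h' : IsEigenvalueSequence Φ.Astar Φ.Estar Φ.θstar := Classical.choose_spec Φ.primitive_star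
  obtain ⟨e, hA, hE⟩ := h.exists_basis hV hρ
  obtain ⟨f, hB, hF⟩ := h'.exists_basis hV hρ
  refine ⟨e, f, ⟨h.1, h'.1, hA, hB, ?_, ?_, ?_, ?_⟩, hE, hF⟩
  · exact fun i j hij => (mul_mul_eq_zero_iff hE hρ.1 _ _ _).1 ((Φ.tridiagonal_star i j).1 hij)
  · exact fun i j hij => mt (mul_mul_eq_zero_iff hE hρ.1 _ _ _).2 ((Φ.tridiagonal_star i j).2 hij)
  · exact fun i j hij => (mul_mul_eq_zero_iff hF hρ.1 _ _ _).1 ((Φ.tridiagonal i j).1 hij)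
  · exact fun i j hij => mt (mul_mul_eq_zero_iff hF hρ.1 _ _ _).2 ((Φ.tridiagonal i j).2 hij)

/-- The operator has rank at most one, so its trace is a single coordinate; this turns the trace
quotients into `splitScalar`. -/
theorem tr_mul_projection {f : Module.Basis (Fin (d + 1)) K V} {F : Fin (d + 1) → 𝒜}
    (hF : ∀ i x, F i • x = f.repr x i • f i) (A : 𝒜) (q : K[X]) (i : Fin (d + 1)) :
    tr K V (aeval A q * F i) = f.repr (aeval (Algebra.lsmul K K V A) q (f i)) i := by
  have : Module.Finite K V := Module.Finite.of_basis f
  have h : Algebra.lsmul K K V (aeval A q * F i) =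
      (f.coord i).smulRight (aeval (Algebra.lsmul K K V A) q (f i)) := by
    ext x
    rw [Algebra.lsmul_apply_eq_smul, mul_smul, hF, aeval_algHom_apply, LinearMap.smulRight_apply]
    exact map_smul (Algebra.lsmul K K V (aeval A q)) _ _
  rw [tr, h, LinearMap.trace_smulRight]
  rfl

theorem image_projection {f : Module.Basis (Fin (d + 1)) K V} {F : Fin (d + 1) → 𝒜}
    (hF : ∀ i x, F i • x = f.repr x i • f i) (a : 𝒜) (i : Fin (d + 1)) :
    image K V (a * F i) = K ∙ (a • f i) := by
  have h (x : V) : Algebra.lsmul K K V (a * F i) x = f.repr x i • a • f i := by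
    rw [Algebra.lsmul_apply_eq_smul, mul_smul, hF]
    exact map_smul (Algebra.lsmul K K V a) _ _
  ext x
  rw [image, LinearMap.mem_range, Submodule.mem_span_singleton]
  constructor
  · rintro ⟨y, rfl⟩
    exact ⟨_, (h y).symm⟩
  · rintro ⟨c, rfl⟩
    exact ⟨c • f i, by rw [h]; simp⟩

variable {Φ : LeonardSystem K 𝒜 d} {e f : Module.Basis (Fin (d + 1)) K V}

theorem firstSplit_eq_splitScalar (hF : ∀ i x, Φ.Estar i • x = f.repr x i • f i) (i : Fin d) :
    Φ.firstSplit V i = splitScalar (Algebra.lsmul K K V Φ.A) f Φ.θ Φ.θstar i := by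
  rw [firstSplit, tr_mul_projection hF, tr_mul_projection hF]
  rfl

theorem secondSplit_eq_splitScalar (hF : ∀ i x, Φ.Estar i • x = f.repr x i • f i) (i : Fin d) :
    Φ.secondSplit V i =
      splitScalar (Algebra.lsmul K K V Φ.A) f (Φ.θ ∘ Fin.rev) Φ.θstar i := by
  rw [secondSplit, tr_mul_projection hF, tr_mul_projection hF]
  rfl

/-- The scalar is forced: the last `f`-coordinate of `q(A) f_0` depends only on the coefficient of
degree `d`. -/
theorem isMonicPoly_last_iff
    (L : IsLeonardBases (Algebra.lsmul K K V Φ.A) (Algebra.lsmul K K V Φ.Astar) e f Φ.θ Φ.θstar)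
    (hF : ∀ i x, Φ.Estar i • x = f.repr x i • f i) (q : K[X]) :
    Φ.IsMonicPoly V (Fin.last d) q ↔ q.Monic ∧ q.natDegree = d ∧
      aeval (Algebra.lsmul K K V Φ.A) q (f 0) =
        f.repr (((Algebra.lsmul K K V Φ.A) ^ d) (f 0)) (Fin.last d) • f (Fin.last d) := by
  have hg : f.repr (((Algebra.lsmul K K V Φ.A) ^ d) (f 0)) (Fin.last d) ≠ 0 :=
    L.repr_pow_self_ne_zero (Fin.last d)
  have h1 : image K V (Φ.Estar (Fin.last d)) = K ∙ f (Fin.last d) := by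
    simpa using image_projection hF 1 (Fin.last d)
  have h2 : aeval Φ.A q • f 0 = aeval (Algebra.lsmul K K V Φ.A) q (f 0) := by
    rw [aeval_algHom_apply]; rfl
  rw [IsMonicPoly, h1, image_projection hF, h2, Fin.val_last]
  refine and_congr_right fun hm => and_congr_right fun hd => ⟨fun h => ?_, fun h => ?_⟩
  · obtain ⟨c, hc⟩ := Submodule.mem_span_singleton.1 (h ▸ Submodule.mem_span_singleton_self _)
    have h3 := L.repr_aeval_apply_f_zero q (Fin.last d) (by rw [hd, Fin.val_last])
    have hcoeff : q.coeff d = 1 := by rw [← hd]; exact hm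
    rw [Fin.val_last, hcoeff, one_mul, ← hc] at h3
    rw [← hc, ← h3]
    simp
  · rw [h, Submodule.span_singleton_smul_eq (IsUnit.mk0 _ hg)]

/-- Two solutions agree on `f 0`, which has no zero `e`-coordinate, so their difference has degree
at most `d` and `d + 1` roots. -/
theorem existsUnique_isMonicPoly_last
    (L : IsLeonardBases (Algebra.lsmul K K V Φ.A) (Algebra.lsmul K K V Φ.Astar) e f Φ.θ Φ.θstar)
    (hF : ∀ i x, Φ.Estar i • x = f.repr x i • f i) :
    ∃! q : K[X], Φ.IsMonicPoly V (Fin.last d) q := by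
  simp only [isMonicPoly_last_iff L hF]
  have hg : f.repr (((Algebra.lsmul K K V Φ.A) ^ d) (f 0)) (Fin.last d) ≠ 0 :=
    L.repr_pow_self_ne_zero (Fin.last d)
  set g := f.repr (((Algebra.lsmul K K V Φ.A) ^ d) (f 0)) (Fin.last d)
  obtain ⟨q, hq, hqf⟩ := L.exists_aeval_eq (g • f (Fin.last d))
  have hc : q.coeff d = 1 := by
    have h := L.repr_aeval_apply_f_zero q (Fin.last d) hq
    rw [hqf] at h
    simp only [map_smul, Module.Basis.repr_self, Finsupp.smul_apply, Finsupp.single_eq_same,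
      smul_eq_mul, mul_one, Fin.val_last] at h
    exact mul_right_cancel₀ hg (by rw [one_mul]; exact h.symm)
  refine ⟨q, ⟨monic_of_natDegree_le_of_coeff_eq_one d hq hc,
    le_antisymm hq (le_natDegree_of_ne_zero (by simp [hc])), hqf⟩, ?_⟩
  rintro r ⟨-, hr, hrf⟩
  rw [← sub_eq_zero]
  refine eq_zero_of_degree_lt_of_eval_index_eq_zero Finset.univ (v := Φ.θ) L.inj.injOn ?_
    fun j _ => ?_
  · rw [Finset.card_univ, Fintype.card_fin, degree_lt_iff_coeff_zero]
    intro m hm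
    rw [coeff_sub, coeff_eq_zero_of_natDegree_lt (by omega),
      coeff_eq_zero_of_natDegree_lt (by omega), sub_zero]
  · have h : aeval (Algebra.lsmul K K V Φ.A) (r - q) (f 0) = 0 := by
      rw [map_sub, LinearMap.sub_apply, hrf, hqf, sub_self]
    have h' := L.repr_aeval (r - q) (f 0) j
    rw [h, map_zero, Finsupp.zero_apply, eq_comm] at h'
    exact (mul_eq_zero.1 h').resolve_right (L.repr_f_zero_ne_zero j)

theorem repr_f_last_div
    (L : IsLeonardBases (Algebra.lsmul K K V Φ.A) (Algebra.lsmul K K V Φ.Astar) e f Φ.θ Φ.θstar)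
    (hF : ∀ i x, Φ.Estar i • x = f.repr x i • f i) (r : Fin (d + 1)) :
    e.repr (f (Fin.last d)) r / e.repr (f 0) r =
      (∏ h ∈ Finset.univ.filter (fun h : Fin d => h.castSucc < r), Φ.secondSplit V h.rev) /
        (∏ h ∈ Finset.univ.filter (fun h : Fin d => h.castSucc < r), Φ.firstSplit V h) *
      (e.repr (f (Fin.last d)) 0 / e.repr (f 0) 0) := by
  induction r using Fin.induction with
  | zero => simp
  | succ i ih =>
    have hs : Finset.univ.filter (fun h : Fin d => h.castSucc < i.succ) =
        insert i (Finset.univ.filter fun h : Fin d => h.castSucc < i.castSucc) := by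
      ext h
      simp only [Finset.mem_filter, Finset.mem_univ, true_and, Finset.mem_insert,
        Fin.castSucc_lt_succ_iff, Fin.castSucc_lt_castSucc_iff]
      exact le_iff_eq_or_lt
    rw [hs, Finset.prod_insert (by simp), Finset.prod_insert (by simp), mul_div_mul_comm,
      mul_assoc, ← ih, L.repr_f_last_succ, secondSplit_eq_splitScalar hF,
      firstSplit_eq_splitScalar hF]

end LeonardSystem

/-! ### The switching element -/

theorem theorem6p5 {K 𝒜 V : Type*} [Field K] [Ring 𝒜] [Algebra K 𝒜] [AddCommGroup V]
    [Module K V] [Module 𝒜 V] [IsScalarTower K 𝒜 V] [IsSimpleModule 𝒜 V] {d : ℕ}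
    (h𝒜 : Nonempty (𝒜 ≃ₐ[K] Matrix (Fin (d + 1)) (Fin (d + 1)) K))
    (Φ : LeonardSystem K 𝒜 d) :
    (∀ i : Fin d,
      LeonardSystem.tr K V (aeval Φ.A (Φ.tau i.castSucc) * Φ.Estar 0) ≠ 0 ∧
      LeonardSystem.tr K V (aeval Φ.A (Φ.eta i.castSucc) * Φ.Estar 0) ≠ 0 ∧
      Φ.firstSplit V i ≠ 0) ∧
    (∃! q : K[X], Φ.IsMonicPoly V (Fin.last d) q) ∧
    (Φ.p V (Fin.last d)).eval (Φ.θ 0) ≠ 0 ∧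
    Φ.switchingElement V = aeval Φ.A (Φ.u V (Fin.last d)) := by
  obtain ⟨φ⟩ := h𝒜
  obtain ⟨ψ⟩ := nonempty_linearEquiv_of_algEquiv_matrix (V := V) φ
  have : FiniteDimensional K V := Module.Finite.equiv ψ
  have hV : Module.finrank K V = d + 1 := by rw [← ψ.finrank_eq]; simp
  have hρ := bijective_lsmul_of_algEquiv_matrix (V := V) φ
  obtain ⟨e, f, L, hE, hF⟩ := Φ.exists_isLeonardBases hV hρ
  have hu := LeonardSystem.existsUnique_isMonicPoly_last L hF
  have hp : Φ.IsMonicPoly V (Fin.last d) (Φ.p V (Fin.last d)) :=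
    Classical.epsilon_spec hu.exists
  have hpf := ((LeonardSystem.isMonicPoly_last_iff L hF _).1 hp).2.2
  have hg : f.repr (((Algebra.lsmul K K V Φ.A) ^ d) (f 0)) (Fin.last d) ≠ 0 :=
    L.repr_pow_self_ne_zero (Fin.last d)
  set g := f.repr (((Algebra.lsmul K K V Φ.A) ^ d) (f 0)) (Fin.last d)
  have hpe (r : Fin (d + 1)) : (Φ.p V (Fin.last d)).eval (Φ.θ r) =
      g * (e.repr (f (Fin.last d)) r / e.repr (f 0) r) := by
    have h := L.repr_aeval (Φ.p V (Fin.last d)) (f 0) r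
    rw [hpf, map_smul, Finsupp.smul_apply, smul_eq_mul] at h
    rw [← mul_div_assoc, h, mul_div_cancel_right₀ _ (L.repr_f_zero_ne_zero r)]
  have hlast : e.repr (f (Fin.last d)) 0 ≠ 0 := by
    simpa using L.reverse_f.repr_f_zero_ne_zero 0
  have hp0 : (Φ.p V (Fin.last d)).eval (Φ.θ 0) ≠ 0 := by
    rw [hpe]
    exact mul_ne_zero hg (div_ne_zero hlast (L.repr_f_zero_ne_zero 0))
  refine ⟨fun i => ⟨?_, ?_, ?_⟩, hu, hp0, ?_⟩
  · rw [LeonardSystem.tr_mul_projection hF]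
    exact L.coord_zero_ne_zero i.castSucc
  · rw [LeonardSystem.tr_mul_projection hF]
    exact L.reverse_e.coord_zero_ne_zero i.castSucc
  · rw [LeonardSystem.firstSplit_eq_splitScalar hF]
    exact L.splitScalar_ne_zero i
  -- `𝒜` acts faithfully, so it suffices to compare `e`-coordinates; at index `r` only the summand
  -- with `E r` survives, and normalising by `p_d(θ_0)` cancels `g` and the ratio at index `0`.
  · apply hρ.1
    rw [← aeval_algHom_apply]
    refine LinearMap.ext fun x => e.repr.injective (Finsupp.ext fun r => ?_)
    rw [L.repr_aeval, LeonardSystem.u, eval_mul, eval_C, hpe, hpe,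
      LeonardSystem.repr_f_last_div L hF r, LeonardSystem.switchingElement, map_sum,
      LinearMap.sum_apply, map_sum, Finsupp.finsetSum_apply, Finset.sum_eq_single r]
    · have h0 := L.repr_f_zero_ne_zero 0
      rw [map_smul, LinearMap.smul_apply, Algebra.lsmul_apply_eq_smul, hE, map_smul, map_smul,
        Finsupp.smul_apply, Finsupp.smul_apply, Module.Basis.repr_self, Finsupp.single_eq_same,
        smul_eq_mul, smul_eq_mul, mul_one]
      congr 1
      field_simp
    · intro k _ hk
      rw [map_smul, LinearMap.smul_apply, Algebra.lsmul_apply_eq_smul, hE, map_smul, map_smul,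
        Finsupp.smul_apply, Finsupp.smul_apply, Module.Basis.repr_self,
        Finsupp.single_eq_of_ne hk.symm, smul_zero, smul_zero]
    · simp
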